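/- For integers $k\ge 1$ and $r\ge 1$ let $$H_k^{(r)}=\sum_{j=1}^{k}\frac{1}{j^r},\qquad O_k^{(r)}=\sum_{j=1}^{k}\frac{1}{(2j-1)^r},\qquad H_k=H_k^{(1)},\quad O_k=O_k^{(1)},$$ and let $G=\sum_{k=0}^{\infty}\frac{(-1)^k}{(2k+1)^2}$ be Catalan's constant. Then the following four series converge, with the sums $$\sum_{k=1}^{\infty}\binom{2k}{k}^3\frac{H_k}{64^k}=\frac{2\pi(\pi-3\ln 2)}{3\,\Gamma(\frac34)^4},\qquad \sum_{k=1}^{\infty}\binom{2k}{k}^3\frac{O_k}{64^k}=\frac{\pi^2}{6\,\Gamma(\frac34)^4},$$ $$\sum_{k=1}^{\infty}\binom{2k}{k}^3\frac{H_k^{(2)}}{64^k}=\frac{\pi(12G-\pi^2)}{3\,\Gamma(\frac34)^4},\qquad \sum_{k=1}^{\infty}\binom{2k}{k}^3\frac{O_k^{(2)}}{64^k}=\frac{\pi(\pi^2-8G)}{8\,\Gamma(\frac34)^4}.$$ -/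

import Mathlib

noncomputable section

/-- The generalized harmonic number `H_k^{(r)} = ∑_{j=1}^k 1/j^r`. -/
def genHarmonic (r k : ℕ) : ℝ :=
  ∑ j ∈ Finset.Icc 1 k, 1 / (j : ℝ) ^ r

/-- The odd harmonic number `O_k^{(r)} = ∑_{j=1}^k 1/(2j-1)^r`. -/
def oddHarmonic (r k : ℕ) : ℝ :=
  ∑ j ∈ Finset.Icc 1 k, 1 / (2 * (j : ℝ) - 1) ^ r

/-- Catalan's constant `G = ∑_{k≥0} (-1)^k/(2k+1)^2` (an absolutely convergent series). -/
def catalanConst : ℝ :=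
  ∑' k : ℕ, (-1 : ℝ) ^ k / (2 * (k : ℝ) + 1) ^ 2

/-- The `k`-th term `C(2k,k)^3 X_k / 64^k` of the series attached to a sequence `X`. -/
def cubeTerm (X : ℕ → ℝ) (k : ℕ) : ℝ :=
  (Nat.choose (2 * k) k : ℝ) ^ 3 * (X k / 64 ^ k)

end

open Filter Topology Finset

noncomputable section

/-! The weight C(2k,k)^3/64^k is the case m = 1 of the summand of F(m) = ₃F₂(1/2, 1/2, m - 1/2; m,
m; 1), a point of both Dixon's well-poised family and Whipple's family. A rational certificate
telescopes the difference of summands, so F(m) = R(m) F(m + 2) (`hyperSum_eq`). Since F(m) → 1 along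
odd m, F(1) = ∏ R(2i + 1), which is a Gamma quotient (`hyperSum_one`).

Harmonic numbers come from moving the parameters inside a summable family: this multiplies the
summand by its logarithmic derivative ∑ δ. If T(m) is the sum so weighted and r the logarithmic
derivative of R, the differentiated recurrence is T(m) = R(m) T(m + 2) + R(m) r(m) F(m + 2). Hence
T/F drops by r(m) from m to m + 2 and tends to 0, giving T(1) = F(1) ∑ r(2i + 1)
(`hasSum_hyperTerm_mul`). No sum is actually differentiated: each differentiated certificate is
checked as a rational identity.

Two first-order directions in Dixon's family produce 2O - 2H and 2O + H; two even second-order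
directions in Whipple's family produce -4 O^(2) and H^(2). The sums of r reduce to Leibniz's series,
log 2, ζ(2) and G. -/

/-- The summand of `₃F₂(1/2, 1/2, m - 1/2; m, m; 1)`. -/
def hyperTerm (m : ℝ) (k : ℕ) : ℝ :=
  ∏ j ∈ range k, ((j : ℝ) + 1 / 2) ^ 2 * (m - 1 / 2 + j) / ((j + 1) * (m + j) ^ 2)

/-- The ratio of the sums of `hyperTerm m` and `hyperTerm (m + 2)`. -/
def sumRatio (m : ℝ) : ℝ := (m + 1 / 2) ^ 4 / (m * (m + 1)) ^ 2

/-- The quotient `hyperTerm (m + 2) k / hyperTerm m k`. -/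
def shiftRatio (m k : ℝ) : ℝ :=
  (m - 1 / 2 + k) * (m + 1 / 2 + k) / ((m - 1 / 2) * (m + 1 / 2)) *
    ((m * (m + 1)) / ((m + k) * (m + k + 1))) ^ 2

/-- The quotient `hyperTerm m (k + 1) / hyperTerm m k`. -/
def stepRatio (m k : ℝ) : ℝ := (k + 1 / 2) ^ 2 * (m - 1 / 2 + k) / ((k + 1) * (m + k) ^ 2)

/-! ### Telescoping certificates and their parameter derivatives -/

/-- The polynomial part of the telescoping certificate. -/
def certPoly (m k : ℝ) : ℝ := (1 / 4 - (k + m - 1 / 2) * (k + 2 * m)) / (m - 1 / 2)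

/-- The telescoping certificate for `hyperTerm m k - sumRatio m * hyperTerm (m + 2) k`. -/
def cert (m k : ℝ) : ℝ := k * certPoly m k / (m + k) ^ 2

/-- Multiplied by `hyperTerm m k`, this exhibits the difference of the two summands as the increment
of `cert m k * hyperTerm m k`. -/
theorem cert_identity {m k : ℝ} (hm : 1 ≤ m) (hk : 0 ≤ k) :
    1 - sumRatio m * shiftRatio m k = cert m (k + 1) * stepRatio m k - cert m k := by
  have h1 : m ≠ 0 := by positivity
  have h2 : m + 1 ≠ 0 := by positivity
  have h3 : 2 * m - 1 ≠ 0 := by linarith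
  have h3' : m - 1 / 2 ≠ 0 := by linarith
  have h3'' : m * 2 - 1 ≠ 0 := by linarith
  have h4 : m + 1 / 2 ≠ 0 := by positivity
  have h5 : m + k ≠ 0 := by positivity
  have h6 : m + k + 1 ≠ 0 := by positivity
  have h7 : k + 1 ≠ 0 := by positivity
  have h9 : 2 * m + 1 ≠ 0 := by positivity
  unfold sumRatio shiftRatio cert stepRatio certPoly
  rw [← add_assoc m k 1]
  field_simp
  ring

/-- Certificate correction for the odd harmonic numbers of order two. -/
def certOddTwo (m k : ℝ) : ℝ := k * ((k + m - 1 / 2) / ((m - 1 / 2) * (m + 1 / 2))) / (m + k) ^ 2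

/-- Derivative of `cert_identity` in t² at t = 0, when the upper pair 1/2, 1/2 becomes 1/2 + t, 1/2
- t (Whipple). The shift ratio does not involve t, hence the factor 0. -/
theorem certOddTwo_identity {m k : ℝ} (hm : 1 ≤ m) (hk : 0 ≤ k) :
    -(sumRatio m * (-2 / (m + 1 / 2) ^ 2) * shiftRatio m k) - sumRatio m * shiftRatio m k * 0 =
      cert m (k + 1) * stepRatio m k * (-1 / (1 / 2 + k) ^ 2) +
        certOddTwo m (k + 1) * stepRatio m k - certOddTwo m k := by
  have h1 : m ≠ 0 := by positivity
  have h2 : m + 1 ≠ 0 := by positivity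
  have h3 : 2 * m - 1 ≠ 0 := by linarith
  have h3' : m - 1 / 2 ≠ 0 := by linarith
  have h3'' : m * 2 - 1 ≠ 0 := by linarith
  have h4 : m + 1 / 2 ≠ 0 := by positivity
  have h5 : m + k ≠ 0 := by positivity
  have h6 : m + k + 1 ≠ 0 := by positivity
  have h7 : k + 1 ≠ 0 := by positivity
  have h8 : 1 + 2 * k ≠ 0 := by positivity
  have h9 : 2 * m + 1 ≠ 0 := by positivity
  unfold sumRatio shiftRatio cert stepRatio certPoly certOddTwo
  rw [← add_assoc m k 1]
  field_simp
  ring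

/-- Certificate correction for the harmonic numbers of order two. -/
def certTwo (m k : ℝ) : ℝ :=
  k * ((-1 - (k + m - 1 / 2) / (m + 1 / 2)) / (m - 1 / 2)) / (m + k) ^ 2 +
    cert m k * (1 / (m + k) ^ 2)

/-- Derivative in s² at s = 0, when the lower pair m, m becomes m + s, m - s; its sum 2m is
unchanged, as Whipple's condition requires. -/
theorem certTwo_identity {m k : ℝ} (hm : 1 ≤ m) (hk : 0 ≤ k) :
    -(sumRatio m * (-2 / (m + 1 / 2) ^ 2 + 1 / m ^ 2 + 1 / (m + 1) ^ 2) * shiftRatio m k) -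
      sumRatio m * shiftRatio m k *
        (1 / (m + k) ^ 2 + 1 / (m + k + 1) ^ 2 - 1 / m ^ 2 - 1 / (m + 1) ^ 2) =
      cert m (k + 1) * stepRatio m k * (1 / (m + k) ^ 2) +
        certTwo m (k + 1) * stepRatio m k - certTwo m k := by
  have h1 : m ≠ 0 := by positivity
  have h2 : m + 1 ≠ 0 := by positivity
  have h3 : 2 * m - 1 ≠ 0 := by linarith
  have h3' : m - 1 / 2 ≠ 0 := by linarith
  have h3'' : m * 2 - 1 ≠ 0 := by linarith
  have h4 : m + 1 / 2 ≠ 0 := by positivity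
  have h5 : m + k ≠ 0 := by positivity
  have h6 : m + k + 1 ≠ 0 := by positivity
  have h7 : k + 1 ≠ 0 := by positivity
  have h9 : 2 * m + 1 ≠ 0 := by positivity
  unfold sumRatio shiftRatio certTwo cert stepRatio certPoly
  rw [← add_assoc m k 1]
  field_simp
  ring

/-- Certificate correction for the derivative along `m`. -/
def certBase (m k : ℝ) : ℝ :=
  k * ((-((k + 2 * m) + 2 * (k + m - 1 / 2)) - certPoly m k) / (m - 1 / 2)) / (m + k) ^ 2 +
    cert m k * (-2 / (m + k))

/-- Derivative of `cert_identity` in m itself. -/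
theorem certBase_identity {m k : ℝ} (hm : 1 ≤ m) (hk : 0 ≤ k) :
    -(sumRatio m * (4 / (m + 1 / 2) - 2 / m - 2 / (m + 1)) * shiftRatio m k) -
      sumRatio m * shiftRatio m k *
        (1 / (m - 1 / 2 + k) + 1 / (m + 1 / 2 + k) - 1 / (m - 1 / 2) - 1 / (m + 1 / 2) -
          2 * (1 / (m + k) + 1 / (m + k + 1) - 1 / m - 1 / (m + 1))) =
      cert m (k + 1) * stepRatio m k * (1 / (m - 1 / 2 + k) - 2 / (m + k)) +
        certBase m (k + 1) * stepRatio m k - certBase m k := by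
  have h1 : m ≠ 0 := by positivity
  have h2 : m + 1 ≠ 0 := by positivity
  have h3 : 2 * m - 1 ≠ 0 := by linarith
  have h3' : m - 1 / 2 ≠ 0 := by linarith
  have h3'' : m * 2 - 1 ≠ 0 := by linarith
  have h4 : m + 1 / 2 ≠ 0 := by positivity
  have h5 : m + k ≠ 0 := by positivity
  have h6 : m + k + 1 ≠ 0 := by positivity
  have h7 : k + 1 ≠ 0 := by positivity
  have h8 : m * 2 - 1 + 2 * k ≠ 0 := by linarith
  have h8' : m - 1 / 2 + k ≠ 0 := by linarith
  have h9 : 2 * m + 1 ≠ 0 := by positivity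
  have h10 : 2 * m + 1 + 2 * k ≠ 0 := by positivity
  unfold sumRatio shiftRatio certBase cert stepRatio certPoly
  rw [← add_assoc m k 1]
  field_simp
  ring

/-- Certificate correction for the derivative along a numerator parameter in the
well-poised direction. -/
def certPoised (m k : ℝ) : ℝ :=
  k * ((-(2 / (m - 1 / 2)) * (k + m - 1 / 2) * (k - 1) - 1 / 2 -
    (2 + 4 / (m - 1 / 2)) * (k + m - 1 / 2)) / (m - 1 / 2)) / (m + k) ^ 2 +
    cert m k * (1 / (m + k))

/-- Derivative in t at t = 0, when one upper 1/2 becomes 1/2 + t and its partner m becomes m - t,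
which keeps the series well-poised (Dixon). -/
theorem certPoised_identity {m k : ℝ} (hm : 1 ≤ m) (hk : 0 ≤ k) :
    -(sumRatio m * (1 / (m - 1 / 2) - 3 / (m + 1 / 2) + 1 / m + 1 / (m + 1)) * shiftRatio m k) -
      sumRatio m * shiftRatio m k *
        (1 / (m + k) + 1 / (m + k + 1) - 1 / m - 1 / (m + 1)) =
      cert m (k + 1) * stepRatio m k * (1 / (1 / 2 + k) + 1 / (m + k)) +
        certPoised m (k + 1) * stepRatio m k - certPoised m k := by
  have h1 : m ≠ 0 := by positivity
  have h2 : m + 1 ≠ 0 := by positivity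
  have h3 : 2 * m - 1 ≠ 0 := by linarith
  have h3' : m - 1 / 2 ≠ 0 := by linarith
  have h3'' : m * 2 - 1 ≠ 0 := by linarith
  have h4 : m + 1 / 2 ≠ 0 := by positivity
  have h5 : m + k ≠ 0 := by positivity
  have h6 : m + k + 1 ≠ 0 := by positivity
  have h7 : k + 1 ≠ 0 := by positivity
  have h8 : 1 + 2 * k ≠ 0 := by positivity
  have h9 : 2 * m + 1 ≠ 0 := by positivity
  unfold sumRatio shiftRatio certPoised cert stepRatio certPoly
  rw [← add_assoc m k 1]
  field_simp
  ring

/-! ### Size of the summand, uniformly in m ≥ 1 -/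

theorem hyperTerm_zero (m : ℝ) : hyperTerm m 0 = 1 := by simp [hyperTerm]

theorem hyperTerm_succ (m : ℝ) (k : ℕ) :
    hyperTerm m (k + 1) = hyperTerm m k * stepRatio m k := by
  rw [hyperTerm, prod_range_succ, ← hyperTerm, stepRatio]

theorem stepRatio_nonneg {m : ℝ} (hm : 1 ≤ m) (k : ℕ) : 0 ≤ stepRatio m k := by
  have : 0 ≤ m - 1 / 2 := by linarith
  unfold stepRatio
  positivity

theorem hyperTerm_nonneg {m : ℝ} (hm : 1 ≤ m) (k : ℕ) : 0 ≤ hyperTerm m k :=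
  prod_nonneg fun j _ => stepRatio_nonneg hm j

theorem stepRatio_anti {m : ℝ} (hm : 1 ≤ m) (k : ℕ) : stepRatio m k ≤ stepRatio 1 k := by
  have hk : (0 : ℝ) ≤ k := k.cast_nonneg
  unfold stepRatio
  rw [div_le_div_iff₀ (by positivity) (by positivity)]
  have key : (m - 1 / 2 + k) * (1 + k) ^ 2 ≤ (1 - 1 / 2 + k) * (m + k) ^ 2 := by
    nlinarith [mul_nonneg (sub_nonneg.2 hm) hk, mul_nonneg (mul_nonneg (sub_nonneg.2 hm) hk) hk,
      mul_nonneg (mul_nonneg (sub_nonneg.2 hm) (sub_nonneg.2 hm)) hk,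
      mul_nonneg (sub_nonneg.2 hm) (sub_nonneg.2 hm)]
  calc _ = ((k : ℝ) + 1 / 2) ^ 2 * (k + 1) * ((m - 1 / 2 + k) * (1 + k) ^ 2) := by ring
    _ ≤ ((k : ℝ) + 1 / 2) ^ 2 * (k + 1) * ((1 - 1 / 2 + k) * (m + k) ^ 2) := by gcongr
    _ = _ := by ring

theorem hyperTerm_anti {m : ℝ} (hm : 1 ≤ m) (k : ℕ) : hyperTerm m k ≤ hyperTerm 1 k :=
  prod_le_prod (fun j _ => stepRatio_nonneg hm j) fun j _ => stepRatio_anti hm j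

theorem hyperTerm_one (k : ℕ) :
    hyperTerm 1 k = (∏ j ∈ range k, ((j : ℝ) + 1 / 2) / (j + 1)) ^ 3 := by
  rw [hyperTerm, ← prod_pow]
  refine prod_congr rfl fun j _ => ?_
  have : (j : ℝ) + 1 ≠ 0 := by positivity
  rw [add_comm (1 : ℝ) j]
  field_simp
  ring

/-- The induction closes because (k + 1/2)² (k + 2) ≤ (k + 1)³. -/
theorem prod_half_sq_le (k : ℕ) :
    (∏ j ∈ range k, ((j : ℝ) + 1 / 2) / (j + 1)) ^ 2 ≤ 1 / (k + 1) := by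
  induction k with
  | zero => simp
  | succ k ih =>
    have hk : (0 : ℝ) ≤ k := k.cast_nonneg
    rw [prod_range_succ, mul_pow]
    calc _ ≤ 1 / ((k : ℝ) + 1) * (((k : ℝ) + 1 / 2) / (k + 1)) ^ 2 := by gcongr
      _ ≤ _ := by
        push_cast
        rw [div_pow, div_mul_div_comm, div_le_div_iff₀ (by positivity) (by positivity)]
        nlinarith

theorem hyperTerm_one_le (k : ℕ) : hyperTerm 1 k ≤ ((k : ℝ) + 1) ^ (-(3 / 2) : ℝ) := by
  have h0 : 0 ≤ ∏ j ∈ range k, ((j : ℝ) + 1 / 2) / (j + 1) :=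
    prod_nonneg fun j _ => by positivity
  have h1 : (∏ j ∈ range k, ((j : ℝ) + 1 / 2) / (j + 1)) ≤ ((k : ℝ) + 1) ^ (-(1 / 2) : ℝ) := by
    refine le_of_sq_le_sq ?_ (by positivity)
    refine (prod_half_sq_le k).trans_eq ?_
    rw [← Real.rpow_natCast (((k : ℝ) + 1) ^ (-(1 / 2) : ℝ)), ← Real.rpow_mul (by positivity)]
    norm_num
    rw [Real.rpow_neg_one]
  rw [hyperTerm_one]
  calc _ ≤ (((k : ℝ) + 1) ^ (-(1 / 2) : ℝ)) ^ 3 := by gcongr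
    _ = _ := by
      rw [← Real.rpow_natCast (((k : ℝ) + 1) ^ (-(1 / 2) : ℝ)), ← Real.rpow_mul (by positivity)]
      norm_num

/-- Logarithmic growth is traded for a quarter power: 5 = 1 + 4, from 1 + log x with log x ≤ 4
x^(1/4). -/
theorem sum_inv_succ_le (k : ℕ) :
    ∑ j ∈ range k, 1 / ((j : ℝ) + 1) ≤ 5 * ((k : ℝ) + 1) ^ (1 / 4 : ℝ) := by
  have h1 : ∑ j ∈ range k, 1 / ((j : ℝ) + 1) ≤ 1 + Real.log k := by
    have := harmonic_le_one_add_log k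
    simpa [harmonic, one_div] using this
  have h2 : Real.log k ≤ Real.log (k + 1) := by
    rcases k.eq_zero_or_pos with rfl | hk
    · simp
    · exact Real.log_le_log (by exact_mod_cast hk) (by linarith)
  have h3 : Real.log ((k : ℝ) + 1) ≤ ((k : ℝ) + 1) ^ (1 / 4 : ℝ) / (1 / 4) :=
    Real.log_le_rpow_div (by positivity) (by norm_num)
  have h4 : 1 ≤ ((k : ℝ) + 1) ^ (1 / 4 : ℝ) :=
    Real.one_le_rpow (by linarith [k.cast_nonneg (α := ℝ)]) (by norm_num)
  linarith

theorem tendsto_hyperTerm {u : ℕ → ℝ} (hu1 : ∀ n, 1 ≤ u n) (hu : Tendsto u atTop atTop) {k : ℕ}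
    (hk : k ≠ 0) : Tendsto (fun n => hyperTerm (u n) k) atTop (𝓝 0) := by
  obtain ⟨k, rfl⟩ := Nat.exists_eq_succ_of_ne_zero hk
  have hle : ∀ n, hyperTerm (u n) (k + 1) ≤ (k + 1) * (u n)⁻¹ := by
    intro n
    have hm := hu1 n
    set m := u n
    have hk0 : (0 : ℝ) ≤ k := k.cast_nonneg
    rw [hyperTerm_succ]
    have h1 : hyperTerm m k ≤ 1 :=
      (hyperTerm_anti hm k).trans ((hyperTerm_one_le k).trans
        (Real.rpow_le_one_of_one_le_of_nonpos (by linarith) (by norm_num)))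
    -- A single factor of order 1/m suffices; the remaining factors are bounded by 1.
    have h2 : stepRatio m k ≤ (k + 1) * m⁻¹ := by
      unfold stepRatio
      rw [← div_eq_mul_inv, div_le_div_iff₀ (by positivity) (by positivity)]
      have e1 : ((k : ℝ) + 1 / 2) ^ 2 ≤ (k + 1) ^ 2 := by gcongr; norm_num
      have e2 : (m - 1 / 2 + k) * m ≤ (m + k) ^ 2 := by nlinarith
      have e3 : 0 ≤ (m - 1 / 2 + k) * m := by
        apply mul_nonneg <;> linarith
      calc _ = ((k : ℝ) + 1 / 2) ^ 2 * ((m - 1 / 2 + k) * m) := by ring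
        _ ≤ ((k : ℝ) + 1) ^ 2 * (m + k) ^ 2 := by gcongr
        _ = _ := by ring
    calc _ ≤ 1 * ((k + 1) * m⁻¹) :=
          mul_le_mul h1 h2 (stepRatio_nonneg hm k) (by norm_num)
      _ = _ := one_mul _
  refine squeeze_zero (fun n => hyperTerm_nonneg (hu1 n) _) hle ?_
  simpa using (tendsto_inv_atTop_zero.comp hu).const_mul ((k : ℝ) + 1)

theorem hyperTerm_shift {m : ℝ} (hm : 1 ≤ m) (k : ℕ) :
    hyperTerm (m + 2) k = hyperTerm m k * shiftRatio m k := by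
  have h1 : m ≠ 0 := by positivity
  have h2 : m + 1 ≠ 0 := by positivity
  have h3 : m - 1 / 2 ≠ 0 := by linarith
  have h4 : m + 1 / 2 ≠ 0 := by positivity
  induction k with
  | zero =>
    simp only [hyperTerm_zero, shiftRatio, Nat.cast_zero, add_zero]
    rw [div_self (mul_ne_zero h3 h4), div_self (mul_ne_zero h1 h2)]
    norm_num
  | succ k ih =>
    have h5 : m + k ≠ 0 := by positivity
    have h6 : m + k + 1 ≠ 0 := by positivity
    have h7 : m + k + 2 ≠ 0 := by positivity
    have h8 : (k : ℝ) + 1 ≠ 0 := by positivity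
    rw [hyperTerm_succ, hyperTerm_succ, ih, mul_assoc, mul_assoc]
    congr 1
    unfold shiftRatio stepRatio
    push_cast
    rw [show m + 2 + (k : ℝ) = m + k + 2 by ring, show m + ((k : ℝ) + 1) = m + k + 1 by ring,
      show m + k + 1 + 1 = m + (k : ℝ) + 2 by ring,
      show m + 2 - 1 / 2 + (k : ℝ) = m + 1 / 2 + (k + 1) by ring,
      show m + 1 / 2 + (k : ℝ) = m - 1 / 2 + (k + 1) by ring]
    field_simp

/-- The common majorant of the summands. -/
def majorant (k : ℕ) : ℝ := 20 * ((k : ℝ) + 1) ^ (-(5 / 4) : ℝ)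

theorem summable_majorant : Summable majorant := by
  refine Summable.mul_left _ ?_
  have := (summable_nat_add_iff 1).2 (Real.summable_nat_rpow.2 (show (-(5 / 4) : ℝ) < -1 by norm_num))
  simpa using this

/-- Certificates grow at most linearly in k, so the boundary terms of the telescoping vanish: (k +
1)^(1 - 5/4) → 0, while -5/4 < -1 still gives summability. -/
theorem tendsto_mul_majorant (C : ℝ) :
    Tendsto (fun k : ℕ => C * ((k : ℝ) + 1) * majorant k) atTop (𝓝 0) := by
  have h1 : Tendsto (fun k : ℕ => ((k : ℝ) + 1) ^ (-(1 / 4) : ℝ)) atTop (𝓝 0) :=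
    (tendsto_rpow_neg_atTop (by norm_num)).comp
      (tendsto_atTop_add_const_right _ _ tendsto_natCast_atTop_atTop)
  have h2 := h1.const_mul (C * 20)
  rw [mul_zero] at h2
  refine h2.congr fun k => ?_
  have : ((k : ℝ) + 1) ^ (-(1 / 4) : ℝ) = (k + 1) * ((k : ℝ) + 1) ^ (-(5 / 4) : ℝ) := by
    rw [← Real.rpow_one_add' (by positivity) (by norm_num)]
    norm_num
  rw [this, majorant]
  ring

theorem hyperTerm_le_majorant {m : ℝ} (hm : 1 ≤ m) (k : ℕ) : hyperTerm m k ≤ majorant k := by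
  refine (hyperTerm_anti hm k).trans ((hyperTerm_one_le k).trans ?_)
  have : ((k : ℝ) + 1) ^ (-(3 / 2) : ℝ) ≤ ((k : ℝ) + 1) ^ (-(5 / 4) : ℝ) :=
    Real.rpow_le_rpow_of_exponent_le (by linarith [k.cast_nonneg (α := ℝ)]) (by norm_num)
  have h0 : 0 ≤ ((k : ℝ) + 1) ^ (-(5 / 4) : ℝ) := by positivity
  unfold majorant
  linarith

theorem abs_sum_le {d : ℕ → ℝ} (hd : ∀ j : ℕ, |d j| ≤ 4 / ((j : ℝ) + 1)) (k : ℕ) :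
    |∑ j ∈ range k, d j| ≤ 20 * ((k : ℝ) + 1) ^ (1 / 4 : ℝ) := by
  calc _ ≤ ∑ j ∈ range k, |d j| := abs_sum_le_sum_abs _ _
    _ ≤ ∑ j ∈ range k, 4 * (1 / ((j : ℝ) + 1)) :=
        sum_le_sum fun j _ => (hd j).trans_eq (by ring)
    _ = 4 * ∑ j ∈ range k, 1 / ((j : ℝ) + 1) := (mul_sum _ _ _).symm
    _ ≤ _ := by linarith [sum_inv_succ_le k]

theorem abs_hyperTerm_mul_le_majorant {m : ℝ} (hm : 1 ≤ m) {d : ℕ → ℝ}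
    (hd : ∀ j : ℕ, |d j| ≤ 4 / ((j : ℝ) + 1)) (k : ℕ) :
    |hyperTerm m k * ∑ j ∈ range k, d j| ≤ majorant k := by
  rw [abs_mul, abs_of_nonneg (hyperTerm_nonneg hm k)]
  calc _ ≤ ((k : ℝ) + 1) ^ (-(3 / 2) : ℝ) * (20 * ((k : ℝ) + 1) ^ (1 / 4 : ℝ)) :=
        mul_le_mul ((hyperTerm_anti hm k).trans (hyperTerm_one_le k)) (abs_sum_le hd k)
          (abs_nonneg _) (by positivity)
    _ = 20 * (((k : ℝ) + 1) ^ (-(3 / 2) : ℝ) * ((k : ℝ) + 1) ^ (1 / 4 : ℝ)) := by ring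
    _ = majorant k := by
      rw [← Real.rpow_add (by positivity), majorant]
      norm_num

/-! ### The recurrence and its derivative -/

/-- The sum of `₃F₂(1/2, 1/2, m - 1/2; m, m; 1)`. -/
def hyperSum (m : ℝ) : ℝ := ∑' k, hyperTerm m k

theorem summable_hyperTerm {m : ℝ} (hm : 1 ≤ m) : Summable (hyperTerm m) :=
  summable_majorant.of_nonneg_of_le (hyperTerm_nonneg hm) (hyperTerm_le_majorant hm)

theorem summable_hyperTerm_mul {m : ℝ} (hm : 1 ≤ m) {d : ℕ → ℝ}
    (hd : ∀ j : ℕ, |d j| ≤ 4 / ((j : ℝ) + 1)) :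
    Summable fun k => hyperTerm m k * ∑ j ∈ range k, d j :=
  summable_majorant.of_norm_bounded fun k => abs_hyperTerm_mul_le_majorant hm hd k

theorem hyperSum_pos {m : ℝ} (hm : 1 ≤ m) : 0 < hyperSum m :=
  (summable_hyperTerm hm).tsum_pos (hyperTerm_nonneg hm) 0 (by simp [hyperTerm_zero])

theorem tsum_eq_zero_of_telescope {f G : ℕ → ℝ} (hf : Summable f)
    (h : ∀ k, f k = G (k + 1) - G k) (h0 : G 0 = 0) (hG : Tendsto G atTop (𝓝 0)) :
    ∑' k, f k = 0 := by
  refine tendsto_nhds_unique hf.hasSum.tendsto_sum_nat ?_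
  simp_rw [h, sum_range_sub, h0, sub_zero]
  exact hG

theorem abs_cubic_div_le {m k A B C : ℝ} (hm : 1 ≤ m) (hk : 0 ≤ k) :
    |k * (A * k ^ 2 + B * k + C) / (m + k) ^ 2| ≤ (|A| + |B| + |C|) * (k + 1) := by
  have h1 : 0 < m + k := by positivity
  rw [abs_div, abs_mul, abs_of_nonneg hk, abs_of_nonneg (sq_nonneg (m + k)),
    div_le_iff₀ (by positivity)]
  have h2 : |A * k ^ 2 + B * k + C| ≤ (|A| + |B| + |C|) * (m + k) ^ 2 := by
    have e1 : |A * k ^ 2 + B * k + C| ≤ |A| * k ^ 2 + |B| * k + |C| := by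
      refine (abs_add_three _ _ _).trans ?_
      rw [abs_mul, abs_mul, abs_of_nonneg hk, abs_of_nonneg (sq_nonneg k)]
    have e2 : k ^ 2 ≤ (m + k) ^ 2 := by gcongr; linarith
    have e3 : k ≤ (m + k) ^ 2 := by nlinarith
    have e4 : 1 ≤ (m + k) ^ 2 := by nlinarith
    calc _ ≤ |A| * k ^ 2 + |B| * k + |C| := e1
      _ ≤ |A| * (m + k) ^ 2 + |B| * (m + k) ^ 2 + |C| * (m + k) ^ 2 := by
        gcongr
        exact le_mul_of_one_le_right (abs_nonneg _) e4
      _ = _ := by ring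
  calc _ ≤ (k + 1) * ((|A| + |B| + |C|) * (m + k) ^ 2) := by gcongr; linarith
    _ = _ := by ring

theorem abs_cert_le {m : ℝ} (hm : 1 ≤ m) : ∃ C, ∀ k : ℕ, |cert m k| ≤ C * ((k : ℝ) + 1) := by
  -- A, B, C are the coefficients of `certPoly m k` as a quadratic in k.
  have := fun k : ℕ => abs_cubic_div_le (A := -1 / (m - 1 / 2))
    (B := -(3 * m - 1 / 2) / (m - 1 / 2))
    (C := (1 / 4 - (m - 1 / 2) * (2 * m)) / (m - 1 / 2)) hm k.cast_nonneg
  refine ⟨_, fun k => le_trans (le_of_eq ?_) (this k)⟩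
  rw [cert, certPoly]
  congr 1
  ring

theorem hyperSum_eq {m : ℝ} (hm : 1 ≤ m) : hyperSum m = sumRatio m * hyperSum (m + 2) := by
  have hm2 : 1 ≤ m + 2 := by linarith
  obtain ⟨C, hC⟩ := abs_cert_le hm
  have h := tsum_eq_zero_of_telescope (G := fun k => cert m k * hyperTerm m k)
    ((summable_hyperTerm hm).sub ((summable_hyperTerm hm2).mul_left (sumRatio m)))
    (fun k => ?_) (by simp [cert]) ?_
  · rw [(summable_hyperTerm hm).tsum_sub ((summable_hyperTerm hm2).mul_left _), tsum_mul_left] at h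
    exact sub_eq_zero.1 h
  · rw [hyperTerm_shift hm, hyperTerm_succ]
    have := cert_identity hm (k.cast_nonneg (α := ℝ))
    push_cast
    linear_combination hyperTerm m k * this
  · refine squeeze_zero_norm (fun k => ?_) (tendsto_mul_majorant C)
    rw [Real.norm_eq_abs, abs_mul, abs_of_nonneg (hyperTerm_nonneg hm k)]
    exact mul_le_mul (hC k) (hyperTerm_le_majorant hm k) (hyperTerm_nonneg hm k)
      ((abs_nonneg _).trans (hC k))

theorem tendsto_oddArg : Tendsto (fun n : ℕ => 2 * (n : ℝ) + 1) atTop atTop :=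
  tendsto_atTop_add_const_right _ _
    (tendsto_natCast_atTop_atTop.const_mul_atTop (by norm_num))

theorem one_le_oddArg (n : ℕ) : 1 ≤ 2 * (n : ℝ) + 1 := by
  linarith [n.cast_nonneg (α := ℝ)]

theorem tendsto_hyperSum : Tendsto (fun n : ℕ => hyperSum (2 * n + 1)) atTop (𝓝 1) := by
  have h := tendsto_tsum_of_dominated_convergence (𝓕 := atTop)
    (f := fun (n : ℕ) k => hyperTerm (2 * n + 1) k) (g := fun k => if k = 0 then (1 : ℝ) else 0)
    summable_majorant (fun k => ?_) (Eventually.of_forall fun n k => ?_)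
  · simpa [hyperSum] using h
  · split_ifs with hk
    · simp [hk, hyperTerm_zero]
    · exact tendsto_hyperTerm one_le_oddArg tendsto_oddArg hk
  · rw [Real.norm_eq_abs, abs_of_nonneg (hyperTerm_nonneg (one_le_oddArg n) k)]
    exact hyperTerm_le_majorant (one_le_oddArg n) k

theorem tendsto_tsum_hyperTerm_mul {δ : ℝ → ℕ → ℝ}
    (hδ : ∀ m, 1 ≤ m → ∀ j : ℕ, |δ m j| ≤ 4 / ((j : ℝ) + 1)) :
    Tendsto (fun n : ℕ => ∑' k, hyperTerm (2 * n + 1) k * ∑ j ∈ range k, δ (2 * n + 1) j) atTop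
      (𝓝 0) := by
  have h := tendsto_tsum_of_dominated_convergence (𝓕 := atTop)
    (f := fun (n : ℕ) k => hyperTerm (2 * n + 1) k * ∑ j ∈ range k, δ (2 * n + 1) j)
    (g := fun _ => (0 : ℝ)) summable_majorant (fun k => ?_) (Eventually.of_forall fun n k => ?_)
  · simpa using h
  · rcases eq_or_ne k 0 with rfl | hk
    · simp
    have h0 := (tendsto_hyperTerm one_le_oddArg tendsto_oddArg hk).mul_const
      (20 * ((k : ℝ) + 1) ^ (1 / 4 : ℝ))
    rw [zero_mul] at h0
    refine squeeze_zero_norm (fun n => ?_) h0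
    rw [Real.norm_eq_abs, abs_mul, abs_of_nonneg (hyperTerm_nonneg (one_le_oddArg n) k)]
    exact mul_le_mul_of_nonneg_left (abs_sum_le (hδ _ (one_le_oddArg n)) k)
      (hyperTerm_nonneg (one_le_oddArg n) k)
  · exact abs_hyperTerm_mul_le_majorant (one_le_oddArg n) (hδ _ (one_le_oddArg n)) k

/-- If the logarithmic derivative `∑ δ` of the summand is telescoped by the certificate correction
`g` against the logarithmic derivative `r` of `sumRatio`, its weighted sum is `∑ r`. -/
theorem hasSum_hyperTerm_mul {δ : ℝ → ℕ → ℝ} {ε g : ℝ → ℕ → ℝ} {r : ℝ → ℝ} {s : ℝ}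
    (hδ : ∀ m, 1 ≤ m → ∀ j : ℕ, |δ m j| ≤ 4 / ((j : ℝ) + 1))
    (hε0 : ∀ m, 1 ≤ m → ε m 0 = 0)
    (hε : ∀ m, 1 ≤ m → ∀ k, δ (m + 2) k - δ m k = ε m (k + 1) - ε m k)
    (hg0 : ∀ m, g m 0 = 0)
    (hg : ∀ m, 1 ≤ m → ∃ C, ∀ k : ℕ, |g m k| ≤ C * ((k : ℝ) + 1))
    (hid : ∀ m, 1 ≤ m → ∀ k : ℕ,
      -(sumRatio m * r m * shiftRatio m k) - sumRatio m * shiftRatio m k * ε m k =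
        cert m (k + 1) * stepRatio m k * δ m k + g m (k + 1) * stepRatio m k - g m k)
    (hr : Tendsto (fun n => ∑ i ∈ range n, r (2 * i + 1)) atTop (𝓝 s)) :
    HasSum (fun k => hyperTerm 1 k * ∑ j ∈ range k, δ 1 j) (hyperSum 1 * s) := by
  set T : ℝ → ℝ := fun m => ∑' k, hyperTerm m k * ∑ j ∈ range k, δ m j with hT
  have hshift : ∀ m, 1 ≤ m → ∀ k,
      ∑ j ∈ range k, δ (m + 2) j = ∑ j ∈ range k, δ m j + ε m k := by
    intro m hm k
    rw [← sub_eq_iff_eq_add', ← sum_sub_distrib, sum_congr rfl fun j _ => hε m hm j,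
      sum_range_sub, hε0 m hm, sub_zero]
  have hrec : ∀ m, 1 ≤ m →
      T m = sumRatio m * T (m + 2) + sumRatio m * r m * hyperSum (m + 2) := by
    intro m hm
    have hm2 : 1 ≤ m + 2 := by linarith
    obtain ⟨C, hC⟩ := abs_cert_le hm
    obtain ⟨C', hC'⟩ := hg m hm
    have s1 := summable_hyperTerm_mul hm (hδ m hm)
    have s2 := (summable_hyperTerm_mul hm2 (hδ _ hm2)).mul_left (sumRatio m)
    have s3 := (summable_hyperTerm hm2).mul_left (sumRatio m * r m)
    have h := tsum_eq_zero_of_telescope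
      (G := fun k => cert m k * (hyperTerm m k * ∑ j ∈ range k, δ m j) + g m k * hyperTerm m k)
      ((s1.sub s2).sub s3) (fun k => ?_) (by simp [cert, hg0]) ?_
    · rw [(s1.sub s2).tsum_sub s3, s1.tsum_sub s2, tsum_mul_left, tsum_mul_left] at h
      simp only [hT, hyperSum]
      linarith
    · rw [hshift m hm, hyperTerm_shift hm, hyperTerm_succ, sum_range_succ]
      have h1 := cert_identity hm (k.cast_nonneg (α := ℝ))
      have h2 := hid m hm k
      push_cast
      -- Product rule: the undifferentiated identity carries the weight ∑ δ, and the differentiated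
      -- one supplies the rest.
      linear_combination hyperTerm m k * (∑ j ∈ range k, δ m j) * h1 + hyperTerm m k * h2
    · have := (tendsto_mul_majorant C).add (tendsto_mul_majorant C')
      rw [add_zero] at this
      refine squeeze_zero_norm (fun k => ?_) this
      refine (norm_add_le _ _).trans (add_le_add ?_ ?_)
      · rw [Real.norm_eq_abs, abs_mul]
        exact mul_le_mul (hC k) (abs_hyperTerm_mul_le_majorant hm (hδ m hm) k) (abs_nonneg _)
          ((abs_nonneg _).trans (hC k))
      · rw [Real.norm_eq_abs, abs_mul, abs_of_nonneg (hyperTerm_nonneg hm k)]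
        exact mul_le_mul (hC' k) (hyperTerm_le_majorant hm k) (hyperTerm_nonneg hm k)
          ((abs_nonneg _).trans (hC' k))
  have hquot : ∀ m, 1 ≤ m → T m / hyperSum m - T (m + 2) / hyperSum (m + 2) = r m := by
    intro m hm
    have h1 := (hyperSum_pos (show 1 ≤ m + 2 by linarith)).ne'
    have h2 : sumRatio m ≠ 0 := by
      unfold sumRatio
      positivity
    rw [hrec m hm, hyperSum_eq hm]
    field_simp
    ring
  have hsum : ∀ n : ℕ, ∑ i ∈ range n, r (2 * i + 1) =
      T 1 / hyperSum 1 - T (2 * n + 1) / hyperSum (2 * n + 1) := by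
    intro n
    have := sum_range_sub' (fun i : ℕ => T (2 * i + 1) / hyperSum (2 * i + 1)) n
    simp only [Nat.cast_zero, mul_zero, zero_add] at this
    rw [← this]
    refine sum_congr rfl fun i _ => ?_
    rw [← hquot _ (one_le_oddArg i)]
    push_cast
    ring_nf
  have hlim : Tendsto (fun n : ℕ => T 1 / hyperSum 1 - T (2 * n + 1) / hyperSum (2 * n + 1)) atTop
      (𝓝 (T 1 / hyperSum 1 - 0 / 1)) :=
    tendsto_const_nhds.sub ((tendsto_tsum_hyperTerm_mul hδ).div tendsto_hyperSum one_ne_zero)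
  have hs : s = T 1 / hyperSum 1 := by
    rw [zero_div, sub_zero] at hlim
    exact tendsto_nhds_unique hr (hlim.congr fun n => (hsum n).symm)
  rw [hs, mul_div_cancel₀ _ (hyperSum_pos le_rfl).ne']
  exact (summable_hyperTerm_mul le_rfl (hδ 1 le_rfl)).hasSum

/-! ### Classical series -/

theorem tendsto_double : Tendsto (fun n : ℕ => 2 * n) atTop atTop :=
  tendsto_id.const_mul_atTop' (by norm_num)

theorem tendsto_sum_leibniz :
    Tendsto (fun n => ∑ i ∈ range n, (1 / (4 * (i : ℝ) + 1) - 1 / (4 * (i : ℝ) + 3))) atTop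
      (𝓝 (Real.pi / 4)) := by
  refine (Real.tendsto_sum_pi_div_four.comp tendsto_double).congr fun n => ?_
  simp only [Function.comp]
  induction n with
  | zero => simp
  | succ n ih =>
    rw [mul_add, mul_one, sum_range_succ, sum_range_succ, ih, sum_range_succ]
    push_cast
    rw [pow_succ, pow_mul]
    norm_num
    ring_nf

theorem tendsto_sum_log_two :
    Tendsto (fun n => ∑ i ∈ range n, (1 / (4 * (i : ℝ) + 1) - 1 / (4 * (i : ℝ) + 2) +
      1 / (4 * (i : ℝ) + 3) - 1 / (4 * (i : ℝ) + 4))) atTop (𝓝 (Real.log 2)) := by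
  have h2 := Real.tendsto_harmonic_sub_log.comp tendsto_double
  have h4 := h2.comp tendsto_double
  have h := (h4.sub h2).add_const (Real.log 2)
  rw [sub_self, zero_add] at h
  refine h.congr' ?_
  filter_upwards [eventually_gt_atTop 0] with n hn
  have hn' : (n : ℝ) ≠ 0 := by exact_mod_cast hn.ne'
  -- The alternating harmonic sum of length 4n is H_{4n} - H_{2n}, so Euler's constant cancels and
  -- log(4n) - log(2n) remains.
  have hs : ∀ n : ℕ, ∑ i ∈ range n, (1 / (4 * (i : ℝ) + 1) - 1 / (4 * (i : ℝ) + 2) +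
      1 / (4 * (i : ℝ) + 3) - 1 / (4 * (i : ℝ) + 4)) =
      ((harmonic (2 * (2 * n)) : ℚ) : ℝ) - ((harmonic (2 * n) : ℚ) : ℝ) := by
    intro n
    induction n with
    | zero => simp
    | succ n ih =>
      rw [sum_range_succ, ih, show 2 * (2 * (n + 1)) = 2 * (2 * n) + 1 + 1 + 1 + 1 by ring,
        show 2 * (n + 1) = 2 * n + 1 + 1 by ring]
      simp only [harmonic_succ]
      push_cast
      rw [show 2 * (2 * (n : ℝ)) + 1 = 4 * n + 1 by ring,
        show 4 * (n : ℝ) + 1 + 1 = 2 * (2 * n + 1) by ring,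
        show 2 * (2 * (n : ℝ)) + 2 + 1 = 4 * n + 3 by ring,
        show 2 * (2 * (n : ℝ)) + 3 + 1 = 2 * (2 * n + 2) by ring,
        show 2 * (n : ℝ) + 1 + 1 = 2 * n + 2 by ring,
        show 4 * (n : ℝ) + 4 = 2 * (2 * n + 2) by ring,
        show 4 * (n : ℝ) + 2 = 2 * (2 * n + 1) by ring]
      simp only [one_div, mul_inv]
      ring
  rw [hs]
  simp only [Function.comp]
  push_cast
  rw [Real.log_mul two_ne_zero (mul_ne_zero two_ne_zero hn')]
  ring

theorem hasSum_odd_sq : HasSum (fun n : ℕ => 1 / (2 * (n : ℝ) + 1) ^ 2) (Real.pi ^ 2 / 8) := by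
  have hz := hasSum_zeta_two
  have he : HasSum (fun n : ℕ => 1 / (((2 * n : ℕ) : ℝ)) ^ 2) (1 / 4 * (Real.pi ^ 2 / 6)) := by
    refine (hz.mul_left (1 / 4)).congr_fun fun n => ?_
    push_cast
    ring
  have ho : Summable (fun n : ℕ => 1 / (((2 * n + 1 : ℕ) : ℝ)) ^ 2) :=
    hz.summable.comp_injective (i := fun n : ℕ => 2 * n + 1) fun a b h => by simpa using h
  have h := (HasSum.even_add_odd (f := fun n : ℕ => 1 / (n : ℝ) ^ 2) he ho.hasSum).unique hz
  have h' : ∑' n : ℕ, 1 / (((2 * n + 1 : ℕ) : ℝ)) ^ 2 = Real.pi ^ 2 / 8 := by linarith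
  have := ho.hasSum
  rw [h'] at this
  simpa using this

theorem hasSum_even_sq : HasSum (fun n : ℕ => 1 / (2 * (n : ℝ) + 2) ^ 2) (Real.pi ^ 2 / 24) := by
  have h := ((hasSum_nat_add_iff' 1).2 hasSum_zeta_two).mul_left (1 / 4)
  simp only [range_one, sum_singleton, Nat.cast_zero] at h
  -- The removed index-0 term is 1 / 0 ^ 2, which is 0 by convention.
  rw [show 1 / 4 * (Real.pi ^ 2 / 6 - 1 / 0 ^ 2) = Real.pi ^ 2 / 24 by norm_num; ring] at h
  refine h.congr_fun fun n => ?_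
  push_cast
  rw [show 2 * (n : ℝ) + 2 = 2 * (n + 1) by ring, mul_pow, one_div_mul_one_div]
  norm_num

theorem hasSum_catalanConst :
    HasSum (fun k : ℕ => (-1 : ℝ) ^ k / (2 * (k : ℝ) + 1) ^ 2) catalanConst := by
  refine Summable.hasSum (hasSum_odd_sq.summable.of_norm_bounded fun k => ?_)
  rw [norm_div, norm_pow, norm_neg, norm_one, one_pow, Real.norm_eq_abs,
    abs_of_nonneg (sq_nonneg _)]

theorem hasSum_three_mod_four_sq :
    HasSum (fun n : ℕ => 1 / (4 * (n : ℝ) + 3) ^ 2) ((Real.pi ^ 2 / 8 - catalanConst) / 2) := by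
  have h := (hasSum_odd_sq.sub hasSum_catalanConst).div_const 2
  have hinj : Function.Injective (fun n : ℕ => 2 * n + 1) := fun a b h => by simpa using h
  -- Half the difference has coefficient (1 - (-1)^k)/2, which selects k = 2n + 1, where 2k + 1 = 4n
  -- + 3.
  rw [← hinj.hasSum_iff] at h
  · refine h.congr_fun fun n => ?_
    simp only [Function.comp]
    rw [pow_succ (-1 : ℝ), pow_mul]
    push_cast
    norm_num
    ring_nf
  · intro k hk
    have hk : Even k := by
      rw [← Nat.not_odd_iff_even]
      rintro ⟨j, rfl⟩
      exact hk ⟨j, rfl⟩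
    rw [hk.neg_one_pow]
    ring

/-! ### The value of F(1) -/

theorem hyperSum_one : hyperSum 1 = Real.pi / Real.Gamma (3 / 4) ^ 4 := by
  have hprod : ∀ n : ℕ, hyperSum 1 =
      (∏ i ∈ range n, sumRatio (2 * i + 1)) * hyperSum (2 * n + 1) := by
    intro n
    induction n with
    | zero => simp
    | succ n ih =>
      rw [ih, prod_range_succ, hyperSum_eq (one_le_oddArg n), mul_assoc]
      push_cast
      ring_nf
  have hG : Tendsto (fun n : ℕ => Real.GammaSeq (1 / 2) n ^ 2 * Real.GammaSeq 1 n ^ 2 /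
      Real.GammaSeq (3 / 4) n ^ 4) atTop (𝓝 (Real.Gamma (1 / 2) ^ 2 * Real.Gamma 1 ^ 2 /
        Real.Gamma (3 / 4) ^ 4)) :=
    (((Real.GammaSeq_tendsto_Gamma _).pow 2).mul ((Real.GammaSeq_tendsto_Gamma _).pow 2)).div
      ((Real.GammaSeq_tendsto_Gamma _).pow 4)
      (pow_ne_zero _ (Real.Gamma_pos_of_pos (by norm_num)).ne')
  rw [Real.Gamma_one_half_eq, Real.sq_sqrt Real.pi_pos.le, Real.Gamma_one, one_pow, mul_one] at hG
  have hS := hG.mul (tendsto_hyperSum.comp (tendsto_add_atTop_nat 1))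
  rw [mul_one] at hS
  refine tendsto_nhds_unique (tendsto_const_nhds.congr' ?_) hS
  filter_upwards [eventually_gt_atTop 0] with n hn
  have hn' : (0 : ℝ) < n := by exact_mod_cast hn
  -- `Real.GammaSeq s n` has n + 1 factors in its denominator, so n + 1 steps of the recurrence are
  -- needed.
  rw [hprod (n + 1), Function.comp]
  congr 1
  have hp : ∏ i ∈ range (n + 1), sumRatio (2 * i + 1) =
      (∏ i ∈ range (n + 1), (3 / 4 + (i : ℝ))) ^ 4 /
        ((∏ i ∈ range (n + 1), (1 / 2 + (i : ℝ))) ^ 2 *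
          (∏ i ∈ range (n + 1), (1 + (i : ℝ))) ^ 2) := by
    rw [← prod_pow, ← prod_pow, ← prod_pow, ← prod_mul_distrib, ← prod_div_distrib]
    refine prod_congr rfl fun i _ => ?_
    unfold sumRatio
    rw [div_eq_div_iff (by positivity) (by positivity)]
    ring
  have p1 : 0 < ∏ i ∈ range (n + 1), (3 / 4 + (i : ℝ)) := prod_pos fun i _ => by positivity
  have p2 : 0 < ∏ i ∈ range (n + 1), (1 / 2 + (i : ℝ)) := prod_pos fun i _ => by positivity
  have p3 : 0 < ∏ i ∈ range (n + 1), (1 + (i : ℝ)) := prod_pos fun i _ => by positivity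
  -- The powers of n cancel since 2 · 1/2 + 2 · 1 = 4 · 3/4.
  have e : ((n : ℝ) ^ (1 / 2 : ℝ)) ^ 2 * ((n : ℝ) ^ (1 : ℝ)) ^ 2 = ((n : ℝ) ^ (3 / 4 : ℝ)) ^ 4 := by
    simp only [← Real.rpow_natCast, ← Real.rpow_mul hn'.le, ← Real.rpow_add hn']
    norm_num
  have hf : (0 : ℝ) < n.factorial := by exact_mod_cast n.factorial_pos
  have hq : 0 < (n : ℝ) ^ (3 / 4 : ℝ) := by positivity
  rw [hp]
  unfold Real.GammaSeq
  simp only [div_pow, mul_pow]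
  rw [div_mul_div_comm, div_div_div_eq,
    show ((n : ℝ) ^ (1 / 2 : ℝ)) ^ 2 * (n.factorial : ℝ) ^ 2 *
      (((n : ℝ) ^ (1 : ℝ)) ^ 2 * (n.factorial : ℝ) ^ 2) =
      (((n : ℝ) ^ (1 / 2 : ℝ)) ^ 2 * ((n : ℝ) ^ (1 : ℝ)) ^ 2) * (n.factorial : ℝ) ^ 4 by ring, e]
  field_simp

/-! ### Harmonic numbers and the four parameter directions -/

theorem cubeTerm_eq (X : ℕ → ℝ) (k : ℕ) : cubeTerm X k = hyperTerm 1 k * X k := by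
  have h : (Nat.choose (2 * k) k : ℝ) = (∏ j ∈ range k, ((j : ℝ) + 1 / 2) / (j + 1)) * 4 ^ k := by
    induction k with
    | zero => simp
    | succ k ih =>
      have h := Nat.succ_mul_centralBinom_succ k
      rw [Nat.centralBinom, Nat.centralBinom] at h
      have h' : ((k : ℝ) + 1) * (Nat.choose (2 * (k + 1)) (k + 1) : ℝ) =
          2 * (2 * k + 1) * Nat.choose (2 * k) k := by exact_mod_cast h
      have hk : (k : ℝ) + 1 ≠ 0 := by positivity
      rw [ih] at h'
      rw [prod_range_succ]
      refine mul_left_cancel₀ hk (h'.trans ?_)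
      field_simp
      ring
  rw [cubeTerm, h, hyperTerm_one, mul_pow, ← pow_mul, mul_comm k 3, pow_mul]
  norm_num
  rw [mul_assoc, mul_div_cancel₀ _ (by positivity)]

theorem hasSum_cubeTerm_succ {X : ℕ → ℝ} {s : ℝ} (h0 : X 0 = 0)
    (h : HasSum (fun k => hyperTerm 1 k * X k) s) :
    HasSum (fun k => cubeTerm X (k + 1)) s := by
  have := (hasSum_nat_add_iff' 1).2 h
  simpa [cubeTerm_eq, h0] using this

theorem genHarmonic_eq (r k : ℕ) :
    genHarmonic r k = ∑ j ∈ range k, 1 / (1 + (j : ℝ)) ^ r := by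
  rw [genHarmonic, ← Finset.Ico_add_one_right_eq_Icc, sum_Ico_eq_sum_range]
  simp

theorem oddHarmonic_eq (r k : ℕ) :
    oddHarmonic r k = ∑ j ∈ range k, 1 / (2 * (j : ℝ) + 1) ^ r := by
  rw [oddHarmonic, ← Finset.Ico_add_one_right_eq_Icc, sum_Ico_eq_sum_range]
  simp only [Nat.add_sub_cancel]
  refine sum_congr rfl fun j _ => ?_
  push_cast
  ring_nf

theorem abs_cubic_add_cert_mul_le {m : ℝ} (hm : 1 ≤ m) (A B C : ℝ) {w g : ℕ → ℝ}
    (hw : ∀ k, |w k| ≤ 2)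
    (hg : ∀ k : ℕ, g k =
      k * (A * (k : ℝ) ^ 2 + B * k + C) / (m + k) ^ 2 + cert m k * w k) :
    ∃ D, ∀ k : ℕ, |g k| ≤ D * ((k : ℝ) + 1) := by
  obtain ⟨D, hD⟩ := abs_cert_le hm
  refine ⟨(|A| + |B| + |C|) + D * 2, fun k => ?_⟩
  rw [hg, add_mul]
  refine (abs_add_le _ _).trans (add_le_add (abs_cubic_div_le hm k.cast_nonneg) ?_)
  rw [abs_mul]
  calc _ ≤ D * ((k : ℝ) + 1) * 2 :=
        mul_le_mul (hD k) (hw k) (abs_nonneg _) ((abs_nonneg _).trans (hD k))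
    _ = _ := by ring

theorem inv_add_nat_le {a : ℝ} (ha : 1 / 2 ≤ a) (j : ℕ) : 1 / (a + j) ≤ 2 / ((j : ℝ) + 1) := by
  have hj : (0 : ℝ) ≤ j := j.cast_nonneg
  rw [div_le_div_iff₀ (by positivity) (by positivity)]
  linarith

theorem inv_add_nat_sq_le {a : ℝ} (ha : 1 / 2 ≤ a) (j : ℕ) :
    1 / (a + j) ^ 2 ≤ 4 / ((j : ℝ) + 1) := by
  have hj : (0 : ℝ) ≤ j := j.cast_nonneg
  rw [div_le_div_iff₀ (by positivity) (by positivity)]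
  nlinarith

theorem one_div_add_nat_le_one {m : ℝ} (hm : 1 ≤ m) (k : ℕ) : 1 / (m + k) ≤ 1 := by
  have hk : (0 : ℝ) ≤ k := k.cast_nonneg
  rw [div_le_one (by positivity)]
  linarith

theorem hasSum_hyperTerm_oddTwo :
    HasSum (fun k => hyperTerm 1 k * ∑ j ∈ range k, -1 / (1 / 2 + (j : ℝ)) ^ 2)
      (hyperSum 1 * (-8 * ((Real.pi ^ 2 / 8 - catalanConst) / 2))) := by
  refine hasSum_hyperTerm_mul (δ := fun _ j => -1 / (1 / 2 + (j : ℝ)) ^ 2) (ε := fun _ _ => 0)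
    (g := fun m k => certOddTwo m k) (r := fun m => -2 / (m + 1 / 2) ^ 2)
    (fun m _ j => ?_) (fun _ _ => rfl) (fun _ _ _ => by ring) (fun m => by simp [certOddTwo])
    (fun m hm => ?_) (fun m hm k => ?_) ?_
  · rw [neg_div, abs_neg, abs_of_nonneg (by positivity)]
    exact inv_add_nat_sq_le le_rfl j
  · refine abs_cubic_add_cert_mul_le hm 0 (1 / ((m - 1 / 2) * (m + 1 / 2)))
      ((m - 1 / 2) / ((m - 1 / 2) * (m + 1 / 2))) (w := fun _ => 0) (by simp) fun k => ?_
    rw [certOddTwo]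
    ring
  · have := certOddTwo_identity hm (k.cast_nonneg (α := ℝ))
    push_cast
    exact this
  · refine (hasSum_three_mod_four_sq.mul_left (-8)).tendsto_sum_nat.congr fun n =>
      sum_congr rfl fun i _ => ?_
    rw [show 2 * (i : ℝ) + 1 + 1 / 2 = (4 * i + 3) / 2 by ring, div_pow, div_div_eq_mul_div]
    ring

theorem hasSum_hyperTerm_two :
    HasSum (fun k => hyperTerm 1 k * ∑ j ∈ range k, 1 / (1 + (j : ℝ)) ^ 2)
      (hyperSum 1 * (-8 * ((Real.pi ^ 2 / 8 - catalanConst) / 2) + Real.pi ^ 2 / 8 +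
        Real.pi ^ 2 / 24)) := by
  refine hasSum_hyperTerm_mul (δ := fun m j => 1 / (m + (j : ℝ)) ^ 2)
    (ε := fun m k => 1 / (m + k) ^ 2 + 1 / (m + k + 1) ^ 2 - 1 / m ^ 2 - 1 / (m + 1) ^ 2)
    (g := fun m k => certTwo m k)
    (r := fun m => -2 / (m + 1 / 2) ^ 2 + 1 / m ^ 2 + 1 / (m + 1) ^ 2)
    (fun m hm j => ?_) (fun m _ => by simp) (fun m _ k => ?_) (fun m => by simp [certTwo, cert])
    (fun m hm => ?_) (fun m hm k => ?_) ?_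
  · rw [abs_of_nonneg (by positivity)]
    exact inv_add_nat_sq_le (by linarith) j
  · push_cast
    ring_nf
  · refine abs_cubic_add_cert_mul_le hm 0 (-(1 / (m + 1 / 2)) / (m - 1 / 2))
      ((-1 - (m - 1 / 2) / (m + 1 / 2)) / (m - 1 / 2)) (w := fun k => 1 / (m + k) ^ 2)
      (fun k => ?_) fun k => ?_
    · rw [abs_of_nonneg (by positivity), ← one_div_pow]
      exact (pow_le_one₀ (by positivity) (one_div_add_nat_le_one hm k)).trans (by norm_num)
    · rw [certTwo]
      ring
  · have := certTwo_identity hm (k.cast_nonneg (α := ℝ))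
    push_cast
    exact this
  · refine (((hasSum_three_mod_four_sq.mul_left (-8)).add hasSum_odd_sq).add
      hasSum_even_sq).tendsto_sum_nat.congr fun n => sum_congr rfl fun i _ => ?_
    rw [show 2 * (i : ℝ) + 1 + 1 / 2 = (4 * i + 3) / 2 by ring, div_pow, div_div_eq_mul_div]
    ring_nf

theorem hasSum_hyperTerm_base :
    HasSum (fun k => hyperTerm 1 k *
      ∑ j ∈ range k, (1 / (1 - 1 / 2 + (j : ℝ)) - 2 / (1 + (j : ℝ))))
      (hyperSum 1 * (-4 * (Real.pi / 4) + 4 * Real.log 2)) := by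
  refine hasSum_hyperTerm_mul (δ := fun m j => 1 / (m - 1 / 2 + (j : ℝ)) - 2 / (m + (j : ℝ)))
    (ε := fun m k => 1 / (m - 1 / 2 + k) + 1 / (m + 1 / 2 + k) - 1 / (m - 1 / 2) -
      1 / (m + 1 / 2) - 2 * (1 / (m + k) + 1 / (m + k + 1) - 1 / m - 1 / (m + 1)))
    (g := fun m k => certBase m k)
    (r := fun m => 4 / (m + 1 / 2) - 2 / m - 2 / (m + 1))
    (fun m hm j => ?_) (fun m _ => by simp) (fun m _ k => ?_) (fun m => by simp [certBase, cert])
    (fun m hm => ?_) (fun m hm k => ?_) ?_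
  · have h1 := inv_add_nat_le (show 1 / 2 ≤ m - 1 / 2 by linarith) j
    have h2 := inv_add_nat_le (show 1 / 2 ≤ m by linarith) j
    have hj : (0 : ℝ) ≤ j := j.cast_nonneg
    have h3 : 0 ≤ 1 / (m - 1 / 2 + (j : ℝ)) := one_div_nonneg.2 (by linarith)
    have h4 : 0 ≤ 1 / (m + (j : ℝ)) := by positivity
    have h5 : 4 / ((j : ℝ) + 1) = 2 * (2 / ((j : ℝ) + 1)) := by ring
    rw [show 2 / (m + (j : ℝ)) = 2 * (1 / (m + j)) by ring, abs_le]
    constructor <;> linarith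
  · push_cast
    ring_nf
  · refine abs_cubic_add_cert_mul_le hm (1 / (m - 1 / 2) / (m - 1 / 2))
      ((-3 + (3 * m - 1 / 2) / (m - 1 / 2)) / (m - 1 / 2))
      ((-(4 * m - 1) - (1 / 4 - (m - 1 / 2) * (2 * m)) / (m - 1 / 2)) / (m - 1 / 2))
      (w := fun k => -2 / (m + k)) (fun k => ?_) fun k => ?_
    · rw [neg_div, abs_neg, abs_of_nonneg (by positivity)]
      have := one_div_add_nat_le_one hm k
      rw [show 2 / (m + (k : ℝ)) = 2 * (1 / (m + k)) by ring]
      linarith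
    · rw [certBase, certPoly]
      ring
  · have := certBase_identity hm (k.cast_nonneg (α := ℝ))
    push_cast
    exact this
  -- At m = 2i + 1 the term of r is 8/(4i+3) - 4/(4i+2) - 4/(4i+4); the missing 1/(4i+1) cancels
  -- between the Leibniz and log 2 series.
  · refine ((tendsto_sum_leibniz.const_mul (-4)).add (tendsto_sum_log_two.const_mul 4)).congr
      fun n => ?_
    rw [mul_sum, mul_sum, ← sum_add_distrib]
    refine sum_congr rfl fun i _ => ?_
    rw [show 2 * (i : ℝ) + 1 + 1 / 2 = (4 * i + 3) / 2 by ring,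
      show 2 * (i : ℝ) + 1 + 1 = (4 * i + 4) / 2 by ring,
      show 2 * (i : ℝ) + 1 = (4 * i + 2) / 2 by ring]
    simp only [div_div_eq_mul_div]
    ring

theorem hasSum_hyperTerm_poised :
    HasSum (fun k => hyperTerm 1 k *
      ∑ j ∈ range k, (1 / (1 / 2 + (j : ℝ)) + 1 / (1 + (j : ℝ))))
      (hyperSum 1 * (4 * (Real.pi / 4) + -2 * Real.log 2)) := by
  refine hasSum_hyperTerm_mul (δ := fun m j => 1 / (1 / 2 + (j : ℝ)) + 1 / (m + (j : ℝ)))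
    (ε := fun m k => 1 / (m + k) + 1 / (m + k + 1) - 1 / m - 1 / (m + 1))
    (g := fun m k => certPoised m k)
    (r := fun m => 1 / (m - 1 / 2) - 3 / (m + 1 / 2) + 1 / m + 1 / (m + 1))
    (fun m hm j => ?_) (fun m _ => by simp) (fun m _ k => ?_) (fun m => by simp [certPoised, cert])
    (fun m hm => ?_) (fun m hm k => ?_) ?_
  · rw [abs_of_nonneg (by positivity)]
    have h1 := inv_add_nat_le (le_refl (1 / 2 : ℝ)) j
    have h2 := inv_add_nat_le (show 1 / 2 ≤ m by linarith) j
    have h5 : 4 / ((j : ℝ) + 1) = 2 * (2 / ((j : ℝ) + 1)) := by ring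
    linarith
  · push_cast
    ring_nf
  · refine abs_cubic_add_cert_mul_le hm (-(2 / (m - 1 / 2)) / (m - 1 / 2))
      ((-(2 / (m - 1 / 2)) * (m - 1 / 2 - 1) - (2 + 4 / (m - 1 / 2))) / (m - 1 / 2))
      ((2 / (m - 1 / 2) * (m - 1 / 2) - 1 / 2 - (2 + 4 / (m - 1 / 2)) * (m - 1 / 2)) /
        (m - 1 / 2))
      (w := fun k => 1 / (m + k)) (fun k => ?_) fun k => ?_
    · rw [abs_of_nonneg (by positivity)]
      exact (one_div_add_nat_le_one hm k).trans (by norm_num)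
    · rw [certPoised]
      ring
  · have := certPoised_identity hm (k.cast_nonneg (α := ℝ))
    push_cast
    exact this
  · refine ((tendsto_sum_leibniz.const_mul 4).add (tendsto_sum_log_two.const_mul (-2))).congr
      fun n => ?_
    rw [mul_sum, mul_sum, ← sum_add_distrib]
    refine sum_congr rfl fun i _ => ?_
    rw [show 2 * (i : ℝ) + 1 + 1 / 2 = (4 * i + 3) / 2 by ring,
      show 2 * (i : ℝ) + 1 - 1 / 2 = (4 * i + 1) / 2 by ring,
      show 2 * (i : ℝ) + 1 + 1 = (4 * i + 4) / 2 by ring,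
      show 2 * (i : ℝ) + 1 = (4 * i + 2) / 2 by ring]
    simp only [div_div_eq_mul_div]
    ring

theorem oddHarmonic_eq_half (r k : ℕ) :
    oddHarmonic r k = (1 / 2) ^ r * ∑ j ∈ range k, 1 / (1 / 2 + (j : ℝ)) ^ r := by
  rw [oddHarmonic_eq, mul_sum]
  refine sum_congr rfl fun j _ => ?_
  rw [show 2 * (j : ℝ) + 1 = 2 * (1 / 2 + j) by ring, mul_pow, one_div_pow, one_div_mul_one_div]

end

theorem mainTheorem1 :
    HasSum (fun k : ℕ => cubeTerm (genHarmonic 1) (k + 1))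
      (2 * Real.pi * (Real.pi - 3 * Real.log 2) / (3 * Real.Gamma (3 / 4) ^ 4)) ∧
    HasSum (fun k : ℕ => cubeTerm (oddHarmonic 1) (k + 1))
      (Real.pi ^ 2 / (6 * Real.Gamma (3 / 4) ^ 4)) ∧
    HasSum (fun k : ℕ => cubeTerm (genHarmonic 2) (k + 1))
      (Real.pi * (12 * catalanConst - Real.pi ^ 2) / (3 * Real.Gamma (3 / 4) ^ 4)) ∧
    HasSum (fun k : ℕ => cubeTerm (oddHarmonic 2) (k + 1))
      (Real.pi * (Real.pi ^ 2 - 8 * catalanConst) / (8 * Real.Gamma (3 / 4) ^ 4)) := by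
  have hΓ : Real.Gamma (3 / 4) ≠ 0 := (Real.Gamma_pos_of_pos (by norm_num)).ne'
  have hb := hasSum_hyperTerm_base
  have hp := hasSum_hyperTerm_poised
  have h2 := hasSum_hyperTerm_two
  have ho := hasSum_hyperTerm_oddTwo
  rw [hyperSum_one] at hb hp h2 ho
  have eb : ∀ k, ∑ j ∈ range k, (1 / (1 - 1 / 2 + (j : ℝ)) - 2 / (1 + (j : ℝ))) =
      2 * oddHarmonic 1 k - 2 * genHarmonic 1 k := by
    intro k
    rw [oddHarmonic_eq_half, genHarmonic_eq, ← mul_assoc, mul_sum, mul_sum, ← sum_sub_distrib]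
    refine sum_congr rfl fun j _ => ?_
    ring_nf
  have ep : ∀ k, ∑ j ∈ range k, (1 / (1 / 2 + (j : ℝ)) + 1 / (1 + (j : ℝ))) =
      2 * oddHarmonic 1 k + genHarmonic 1 k := by
    intro k
    rw [oddHarmonic_eq_half, genHarmonic_eq, ← mul_assoc, mul_sum, ← sum_add_distrib]
    refine sum_congr rfl fun j _ => ?_
    ring_nf
  have eo : ∀ k, ∑ j ∈ range k, -1 / (1 / 2 + (j : ℝ)) ^ 2 = -4 * oddHarmonic 2 k := by
    intro k
    rw [oddHarmonic_eq_half, ← mul_assoc, mul_sum]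
    refine sum_congr rfl fun j _ => ?_
    ring
  simp only [eb] at hb
  simp only [ep] at hp
  simp only [eo] at ho
  simp only [← genHarmonic_eq] at h2
  refine ⟨?_, ?_, ?_, ?_⟩ <;> refine hasSum_cubeTerm_succ (by simp [genHarmonic, oddHarmonic]) ?_
  -- Elimination between 2O + H and 2O - 2H: their difference is 3H, and twice the first plus the
  -- second is 6O.
  · have h := (hp.sub hb).mul_left (1 / 3)
    rw [show 1 / 3 * (Real.pi / Real.Gamma (3 / 4) ^ 4 * (4 * (Real.pi / 4) + -2 * Real.log 2) -
        Real.pi / Real.Gamma (3 / 4) ^ 4 * (-4 * (Real.pi / 4) + 4 * Real.log 2)) =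
      2 * Real.pi * (Real.pi - 3 * Real.log 2) / (3 * Real.Gamma (3 / 4) ^ 4) by
        field_simp; ring] at h
    exact h.congr_fun fun k => by ring
  · have h := ((hp.mul_left 2).add hb).mul_left (1 / 6)
    rw [show 1 / 6 * (2 * (Real.pi / Real.Gamma (3 / 4) ^ 4 *
        (4 * (Real.pi / 4) + -2 * Real.log 2)) +
        Real.pi / Real.Gamma (3 / 4) ^ 4 * (-4 * (Real.pi / 4) + 4 * Real.log 2)) =
      Real.pi ^ 2 / (6 * Real.Gamma (3 / 4) ^ 4) by field_simp; ring] at h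
    exact h.congr_fun fun k => by ring
  · rw [show Real.pi * (12 * catalanConst - Real.pi ^ 2) / (3 * Real.Gamma (3 / 4) ^ 4) =
      Real.pi / Real.Gamma (3 / 4) ^ 4 * (-8 * ((Real.pi ^ 2 / 8 - catalanConst) / 2) +
        Real.pi ^ 2 / 8 + Real.pi ^ 2 / 24) by field_simp; ring]
    exact h2
  · have h := ho.mul_left (-1 / 4)
    rw [show -1 / 4 * (Real.pi / Real.Gamma (3 / 4) ^ 4 *
        (-8 * ((Real.pi ^ 2 / 8 - catalanConst) / 2))) =
      Real.pi * (Real.pi ^ 2 - 8 * catalanConst) / (8 * Real.Gamma (3 / 4) ^ 4) by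
        field_simp; ring] at h
    exact h.congr_fun fun k => by ring
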